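/- Let $m,n\ge 1$ be integers and $a,b\in\mathbb R$. Let $S$ be the generalized Thue–Morse substitution $S(a)=a^mb^n$, $S(b)=b^na^m$ (acting on the symbols $a,b$ and extended to words by concatenation). Let $u=\lim_{k\to\infty}S^k(a)$ be the one-sided infinite fixed point starting with $a$, and let $\Omega$ be the subshift of all two-sided sequences $\omega=(\omega_k)_{k\in\mathbb Z}$ over the two symbols all of whose finite subwords occur in $u$. For $\omega\in\Omega$ let $V_\omega(k)=\omega_k$, $k\in\mathbb Z$ (each symbol being read as the corresponding real number), and let $$(H_\omega\psi)(k)=\psi(k-1)+\psi(k+1)+V_\omega(k)\psi(k)\qquad\text{in } \ell^2(\mathbb Z).$$ For $p>0$ and $T>0$ put $$\langle|X|^p_{\delta_1}\rangle(T)=\sum_{k\in\mathbb Z}|k|^p\,\frac1T\int_0^\infty e^{-2t/T}\,|\langle\delta_k,e^{-itH_\omega}\delta_1\rangle|^2\,dt,\qquad \beta^-_{\delta_1}(p)=\liminf_{T\to+\infty}\frac{\log\langle|X|^p_{\delta_1}\rangle(T)}{\log T}.$$ For $x,E\in\mathbb R$ let $T(x,E)=\begin{pmatrix}E-x&-1\\1&0\end{pmatrix}$.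 Then: (a) If at least one of $m,n$ is even, then for every $\omega\in\Omega$ the operator $H_\omega$ satisfies $\beta^-_{\delta_1}(p)\ge p-1$ for every $p>0$ if $|a-b|<2$, and $\beta^-_{\delta_1}(p)\ge\frac{p-5}{2}$ for every $p>0$ if $|a-b|=2$. (b) If $m\ge3$ is odd, then there are exactly $m-1$ energies $E_0\in\mathbb R$ with $T(a,E_0)^m=I$ or $T(a,E_0)^m=-I$, and for each such $E_0$ and every $\omega\in\Omega$ the operator $H_\omega$ satisfies $\beta^-_{\delta_1}(p)\ge p-1$ for every $p>0$ if $|b-E_0|<2$, and $\beta^-_{\delta_1}(p)\ge\frac{p-5}{2}$ for every $p>0$ if $|b-E_0|=2$. Likewise, if $n\ge3$ is odd, then there are exactly $n-1$ energies $E_0\in\mathbb R$ with $T(b,E_0)^n=I$ or $T(b,E_0)^n=-I$, and for each such $E_0$ and every $\omega\in\Omega$ the operator $H_\omega$ satisfies $\beta^-_{\delta_1}(p)\ge p-1$ for every $p>0$ if $|a-E_0|<2$, and $\beta^-_{\delta_1}(p)\ge\frac{p-5}{2}$ for every $p>0$ if $|a-E_0|=2$. (c) If $m=n=1$, then for every $\omega\in\Omega$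 the operator $H_\omega$ satisfies $\beta^-_{\delta_1}(p)\ge p-1$ for every $p>0$. -/

import Mathlib

open Filter MeasureTheory
open scoped ENNReal

noncomputable section

namespace ThueMorseDynamics

/-! ## Generalized Thue-Morse substitutions and their subshifts -/

/-- The two abstract symbols of the alphabet. -/
inductive Letter
  | a
  | b

/-- The substitution `S(a) = a^m b^n`, `S(b) = b^n a^m` on letters. -/
def substLetter (m n : ℕ) : Letter → List Letter
  | Letter.a => List.replicate m Letter.a ++ List.replicate n Letter.b
  | Letter.b => List.replicate n Letter.b ++ List.replicate m Letter.a

/-- The extension of the substitution to words, by concatenation. -/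
def substWord (m n : ℕ) (w : List Letter) : List Letter :=
  w.flatMap (substLetter m n)

/-- The word `S^k(a)`. -/
def iterWord (m n k : ℕ) : List Letter :=
  (substWord m n)^[k] [Letter.a]

/-- The one-sided infinite sequence `u = lim S^k(a)`. For `m, n ≥ 1` each word `S^k(a)` is a
prefix of the next one and has length `(m + n)^k > k`, so the letter of `u` at place `j` can be
read off from `S^j(a)`; see `getElem?_iterWord` below. -/
def fixedPoint (m n : ℕ) (j : ℕ) : Letter :=
  (iterWord m n j).getD j Letter.a

/-- The subshift generated by the substitution: all two-sided sequences whose finite subwords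
all occur in `u`. -/
def subshift (m n : ℕ) : Set (ℤ → Letter) :=
  {ω | ∀ (i : ℤ) (L : ℕ), ∃ j : ℕ, ∀ k : ℕ, k < L → ω (i + k) = fixedPoint m n (j + k)}

theorem iterWord_succ (m n k : ℕ) :
    iterWord m n (k + 1) = substWord m n (iterWord m n k) :=
  Function.iterate_succ_apply' _ _ _

theorem length_iterWord (m n k : ℕ) : (iterWord m n k).length = (m + n) ^ k := by
  have h : ∀ w : List Letter, (substWord m n w).length = (m + n) * w.length := by
    intro w
    induction w with
    | nil => simp [substWord]
    | cons c w ih =>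
      have hc : (substLetter m n c).length = m + n := by
        cases c
        · simp [substLetter]
        · simp [substLetter, add_comm]
      have e : substWord m n (c :: w) = substLetter m n c ++ substWord m n w := rfl
      rw [e, List.length_append, ih, hc, List.length_cons]
      ring
  induction k with
  | zero => simp [iterWord]
  | succ k ih => rw [iterWord_succ, h, ih, pow_succ, mul_comm]

theorem iterWord_prefix_succ (m n k : ℕ) (hm : 1 ≤ m) :
    iterWord m n k <+: iterWord m n (k + 1) := by
  induction k with
  | zero =>
    obtain ⟨m, rfl⟩ : ∃ m', m = m' + 1 := ⟨m - 1, by omega⟩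
    refine ⟨List.replicate m Letter.a ++ List.replicate n Letter.b, ?_⟩
    simp [iterWord, substWord, substLetter, List.replicate_succ]
  | succ k ih =>
    obtain ⟨t, ht⟩ := ih
    refine ⟨substWord m n t, ?_⟩
    calc iterWord m n (k + 1) ++ substWord m n t
        = substWord m n (iterWord m n k) ++ substWord m n t := by rw [iterWord_succ]
      _ = substWord m n (iterWord m n k ++ t) := List.flatMap_append.symm
      _ = iterWord m n (k + 1 + 1) := by rw [ht, ← iterWord_succ]

theorem iterWord_prefix (m n k l : ℕ) (hm : 1 ≤ m) (hkl : k ≤ l) :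
    iterWord m n k <+: iterWord m n l := by
  induction l, hkl using Nat.le_induction with
  | base => exact List.prefix_refl _
  | succ l _ ih => exact ih.trans (iterWord_prefix_succ m n l hm)

/-- Every word `S^k(a)` is a prefix of the sequence `u`. -/
theorem getElem?_iterWord (m n k j : ℕ) (hm : 1 ≤ m) (hn : 1 ≤ n)
    (hj : j < (iterWord m n k).length) : (iterWord m n k)[j]? = some (fixedPoint m n j) := by
  have hlt : j < (iterWord m n j).length := by
    rw [length_iterWord]
    exact Nat.lt_pow_self (by omega)
  have h1 : (iterWord m n j)[j]? = some (fixedPoint m n j) := by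
    rw [fixedPoint, List.getD_eq_getElem?_getD, List.getElem?_eq_getElem hlt]
    rfl
  rcases le_total k j with h | h
  · obtain ⟨t, ht⟩ := iterWord_prefix m n k j hm h
    rw [← h1, ← ht, List.getElem?_append_left hj]
  · obtain ⟨t, ht⟩ := iterWord_prefix m n j k hm h
    rw [← h1, ← ht, List.getElem?_append_left hlt]

/-- The real number that the letter stands for. -/
def letterValue (a b : ℝ) : Letter → ℝ
  | Letter.a => a
  | Letter.b => b

/-! ## Discrete Schrödinger operators on the whole line -/

/-- The Hilbert space `ℓ²(ℤ)`. -/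
abbrev ell2 : Type := lp (fun _ : ℤ => ℂ) 2

theorem memlp_reindex (e : ℤ ≃ ℤ) (f : ell2) : Memℓp (fun i => f (e i)) 2 :=
  memℓp_gen ((e.summable_iff (f := fun i => ‖f i‖ ^ (2 : ℝ≥0∞).toReal)).2
    ((lp.memℓp f).summable (by norm_num)))

/-- Reindexing `(f(i))_i ↦ (f(e(i)))_i` as a bounded operator. -/
def reindex (e : ℤ ≃ ℤ) : ell2 →L[ℂ] ell2 :=
  LinearMap.mkContinuous
    { toFun := fun f => ⟨fun i => f (e i), memlp_reindex e f⟩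
      map_add' := fun _ _ => lp.ext rfl
      map_smul' := fun _ _ => lp.ext rfl } 1 (by
    intro f
    rw [one_mul]
    refine lp.norm_le_of_tsum_le (by norm_num) (norm_nonneg _) ?_
    rw [lp.norm_rpow_eq_tsum (by norm_num) f]
    exact (e.tsum_eq fun i => ‖f i‖ ^ (2 : ℝ≥0∞).toReal).le)

theorem norm_rpow_mul_le (V : BoundedContinuousFunction ℤ ℝ) (f : ell2) (i : ℤ) :
    ‖(V i : ℂ) * f i‖ ^ (2 : ℝ≥0∞).toReal
      ≤ ‖V‖ ^ (2 : ℝ≥0∞).toReal * ‖f i‖ ^ (2 : ℝ≥0∞).toReal := by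
  rw [← Real.mul_rpow (norm_nonneg _) (norm_nonneg _), norm_mul, Complex.norm_real]
  have := V.norm_coe_le_norm i
  gcongr

theorem memlp_mul (V : BoundedContinuousFunction ℤ ℝ) (f : ell2) :
    Memℓp (fun i => (V i : ℂ) * f i) 2 :=
  memℓp_gen (Summable.of_nonneg_of_le (fun _ => by positivity) (norm_rpow_mul_le V f)
    (((lp.memℓp f).summable (by norm_num)).mul_left _))

/-- Multiplication by a bounded real potential. -/
def mulPotential (V : BoundedContinuousFunction ℤ ℝ) : ell2 →L[ℂ] ell2 :=
  LinearMap.mkContinuous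
    { toFun := fun f => ⟨fun i => (V i : ℂ) * f i, memlp_mul V f⟩
      map_add' := fun f g => lp.ext (funext fun i => mul_add (V i : ℂ) (f i) (g i))
      map_smul' := fun c f => lp.ext (funext fun i => mul_left_comm (V i : ℂ) c (f i)) } ‖V‖ (by
    intro f
    refine lp.norm_le_of_tsum_le (by norm_num) (by positivity) ?_
    rw [Real.mul_rpow (norm_nonneg _) (norm_nonneg _), lp.norm_rpow_eq_tsum (by norm_num) f,
      ← tsum_mul_left]
    have hs := ((lp.memℓp f).summable (p := 2) (by norm_num)).mul_left
      (‖V‖ ^ (2 : ℝ≥0∞).toReal)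
    exact (Summable.of_nonneg_of_le (fun _ => by positivity) (norm_rpow_mul_le V f) hs).tsum_le_tsum
      (norm_rpow_mul_le V f) hs)

/-- The Schrödinger operator `(Hψ)(n) = ψ(n-1) + ψ(n+1) + V(n) ψ(n)` in `ℓ²(ℤ)`; the topology on
`ℤ` is discrete, so `V` is an arbitrary bounded real sequence. -/
def schrodinger (V : BoundedContinuousFunction ℤ ℝ) : ell2 →L[ℂ] ell2 :=
  reindex (Equiv.subRight 1) + reindex (Equiv.addRight 1) + mulPotential V

theorem schrodinger_apply (V : BoundedContinuousFunction ℤ ℝ) (ψ : ell2) (n : ℤ) :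
    schrodinger V ψ n = ψ (n - 1) + ψ (n + 1) + (V n : ℂ) * ψ n := rfl

/-- The unit vector `δ_n`. -/
def delta (n : ℤ) : ell2 := lp.single 2 n 1

/-- The time evolution `exp(-itH) δ₁` of the initial state `δ₁`. -/
def evolution (V : BoundedContinuousFunction ℤ ℝ) (t : ℝ) : ell2 :=
  NormedSpace.exp ((-(Complex.I * (t : ℂ))) • schrodinger V) (delta 1)

/-- `a(n,T) = (1/T) ∫₀^∞ e^{-2t/T} |⟨δ_n, exp(-itH) δ₁⟩|² dt`. -/
def avgProb (V : BoundedContinuousFunction ℤ ℝ) (n : ℤ) (T : ℝ) : ℝ :=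
  1 / T * ∫ t in Set.Ioi (0 : ℝ),
    Real.exp (-2 * t / T) * ‖inner ℂ (delta n) (evolution V t)‖ ^ 2

/-- The time-averaged moment `∑_n |n|^p a(n,T)` of the initial state `δ₁`, a sum of nonnegative
terms with value in `[0,∞]`. -/
def moment (V : BoundedContinuousFunction ℤ ℝ) (p T : ℝ) : ℝ≥0∞ :=
  ∑' n : ℤ, ENNReal.ofReal (|(n : ℝ)| ^ p * avgProb V n T)

/-- The lower growth exponent `β⁻(p) = liminf_{T → ∞} log (moment p T) / log T` of the initial
state `δ₁`, as an extended real number. -/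
def betaMinus (V : BoundedContinuousFunction ℤ ℝ) (p : ℝ) : EReal :=
  liminf (fun T : ℝ => ENNReal.log (moment V p T) / ((Real.log T : ℝ) : EReal)) atTop

/-- The one-step transfer matrix `T(x;E)`. -/
def transfer (x E : ℝ) : Matrix (Fin 2) (Fin 2) ℝ :=
  !![E - x, -1; 1, 0]

/-- The potential `V_ω(n) = ω_n`, the letters being read as the real numbers `a` and `b`. -/
def potential (a b : ℝ) (ω : ℤ → Letter) : BoundedContinuousFunction ℤ ℝ :=
  BoundedContinuousFunction.ofNormedAddCommGroupDiscrete (fun n => letterValue a b (ω n))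
    (max |a| |b|) (by
      intro n
      cases h : ω n
      · simp [letterValue]
      · simp [letterValue])

/-- The set of energies `E` with `T(x;E)^k = ±I`. -/
def resonantEnergies (x : ℝ) (k : ℕ) : Set ℝ :=
  {E | transfer x E ^ k = 1 ∨ transfer x E ^ k = -1}

end ThueMorseDynamics

end

noncomputable section

namespace ThueMorseDynamics

/-! ## The time evolution and its Laplace transform -/

/-! One good energy is enough for transport. Suppose that at some real `E` the transfer matrices
over stretches of length n are O(n^α), uniformly in position. At z = E + 2i/T this bound survives up
to length N ~ T^γ, γ = 1/(1+α), because the accumulated error |z - E| · N^α · N stays bounded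
(`norm_cocycle_step_le`). The Laplace transform `green` of the evolution solves (H - z)g = -iδ₁. The
source keeps g from being small near site 1, and determinant-one transfer matrices of norm O(N^α)
let it decay no faster than N^(-α) on one side (`green_lower_bound`). Cauchy–Schwarz gives a(n,T) ≥
2T⁻²|g(n)|². About N sites at distance at least N then give a moment of order N · N^p · T⁻² ·
N^(-2α), with exponent (p-1-4α)/(1+α) (`le_betaMinus_of_norm_cocycle_le`).

Good energies come from the substitution. If T(a,E)^m = ±I, the blocks a^m b^n and b^n a^m both have
transfer matrix ±T(b,E)^n, so long products are, up to sign and boundary pieces, powers of one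
matrix: bounded if |b - E| < 2 (α = 0), of linear growth if |b - E| = 2 (α = 1). The roles of a and
b can be exchanged. For even m the energy E = a works, since T(a,a)² = -I; in general the resonances
are zeros of a Chebyshev polynomial. For m = n = 1, an energy with (E-a)(E-b) = 2 makes every block
of length 8 have transfer matrix I. -/

theorem isSelfAdjoint_schrodinger (V : BoundedContinuousFunction ℤ ℝ) :
    IsSelfAdjoint (schrodinger V) := by
  rw [ContinuousLinearMap.isSelfAdjoint_iff_isSymmetric]
  intro f g
  change inner ℂ (schrodinger V f) g = inner ℂ f (schrodinger V g)
  have e1 : inner ℂ (reindex (Equiv.subRight 1) f) g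
      = inner ℂ f (reindex (Equiv.addRight 1) g) := by
    rw [lp.inner_eq_tsum, lp.inner_eq_tsum, ← (Equiv.addRight (1 : ℤ)).tsum_eq]
    refine tsum_congr fun i => ?_
    change inner ℂ (f (i + 1 - 1)) (g (i + 1)) = inner ℂ (f i) (g (i + 1))
    rw [add_sub_cancel_right]
  have e2 : inner ℂ (reindex (Equiv.addRight 1) f) g
      = inner ℂ f (reindex (Equiv.subRight 1) g) := by
    rw [lp.inner_eq_tsum, lp.inner_eq_tsum, ← (Equiv.subRight (1 : ℤ)).tsum_eq]
    refine tsum_congr fun i => ?_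
    change inner ℂ (f (i - 1 + 1)) (g (i - 1)) = inner ℂ (f i) (g (i - 1))
    rw [sub_add_cancel]
  have e3 : inner ℂ (mulPotential V f) g = inner ℂ f (mulPotential V g) := by
    rw [lp.inner_eq_tsum, lp.inner_eq_tsum]
    refine tsum_congr fun i => ?_
    change inner ℂ ((V i : ℂ) * f i) (g i) = inner ℂ (f i) ((V i : ℂ) * g i)
    simp only [RCLike.inner_apply, map_mul, Complex.conj_ofReal]
    ring
  simp only [schrodinger, add_apply, inner_add_left, inner_add_right, e1, e2,
    e3]
  ring

theorem norm_evolution_le (V : BoundedContinuousFunction ℤ ℝ) (t : ℝ) :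
    ‖evolution V t‖ ≤ 1 := by
  have hskew : (-(Complex.I * (t : ℂ))) • schrodinger V ∈ skewAdjoint (ell2 →L[ℂ] ell2) :=
    (isSelfAdjoint_schrodinger V).smul_mem_skewAdjoint (by
      rw [skewAdjoint.mem_iff]
      simp)
  let _ : NormedAlgebra ℚ (ell2 →L[ℂ] ell2) := NormedAlgebra.restrictScalars ℚ ℂ _
  have hu := NormedSpace.exp_mem_unitary_of_mem_skewAdjoint hskew
  have hd : ‖delta 1‖ = 1 := by
    rw [delta, lp.norm_single (by norm_num)]
    simp
  exact ((ContinuousLinearMap.norm_map_of_mem_unitary hu _).trans hd).le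

theorem norm_evolution_apply_le (V : BoundedContinuousFunction ℤ ℝ) (t : ℝ) (n : ℤ) :
    ‖evolution V t n‖ ≤ 1 :=
  (lp.norm_apply_le_norm (by norm_num) _ n).trans (norm_evolution_le V t)

theorem evolution_zero (V : BoundedContinuousFunction ℤ ℝ) : evolution V 0 = delta 1 := by
  simp [evolution]

theorem hasDerivAt_evolution_apply (V : BoundedContinuousFunction ℤ ℝ) (t : ℝ) (n : ℤ) :
    HasDerivAt (fun s : ℝ => evolution V s n)
      (-Complex.I * (evolution V t (n - 1) + evolution V t (n + 1)
        + (V n : ℂ) * evolution V t n)) t := by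
  -- Differentiate the operator exponential in a complex time, restrict to real time, apply it to
  -- δ₁, and take the n-th coordinate.
  have h1 := hasDerivAt_exp_smul_const' (𝕂 := ℂ) ((-Complex.I) • schrodinger V) (t : ℂ)
  have h2 := h1.scomp t (Complex.ofRealCLM.hasDerivAt (x := t))
  have h3 := ((ContinuousLinearMap.apply ℂ ell2 (delta 1)).restrictScalars ℝ).hasFDerivAt.comp_hasDerivAt
    t h2
  have h4 := ((lp.evalCLM ℂ (fun _ : ℤ => ℂ) 2 n).restrictScalars ℝ).hasFDerivAt.comp_hasDerivAt
    t h3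
  have e : ∀ s : ℝ, (-(Complex.I * (s : ℂ))) • schrodinger V
      = (s : ℂ) • (-Complex.I) • schrodinger V := by
    intro s
    rw [smul_smul]
    congr 1
    ring
  refine (h4.congr_deriv ?_).congr_of_eventuallyEq (Eventually.of_forall fun s => ?_)
  · rw [show Complex.ofRealCLM 1 = 1 by simp, one_smul]
    change ((-Complex.I) • schrodinger V) (NormedSpace.exp ((t : ℂ) • (-Complex.I) • schrodinger V) (delta 1)) n = _
    rw [← e]
    rfl
  · change evolution V s n = NormedSpace.exp ((s : ℂ) • (-Complex.I) • schrodinger V) (delta 1) n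
    rw [← e]
    rfl

theorem continuous_evolution_apply (V : BoundedContinuousFunction ℤ ℝ) (n : ℤ) :
    Continuous (fun t : ℝ => evolution V t n) :=
  continuous_iff_continuousAt.2 fun t => (hasDerivAt_evolution_apply V t n).continuousAt

/-- The Laplace transform `∫₀^∞ e^{izt} ⟨δ_n, exp(-itH) δ₁⟩ dt`, which is `-i` times the matrix
element of the resolvent. -/
def green (V : BoundedContinuousFunction ℤ ℝ) (z : ℂ) (n : ℤ) : ℂ :=
  ∫ t in Set.Ioi (0 : ℝ), Complex.exp (Complex.I * z * t) * evolution V t n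

theorem norm_exp_I_mul (z : ℂ) (t : ℝ) :
    ‖Complex.exp (Complex.I * z * t)‖ = Real.exp (-z.im * t) := by
  rw [Complex.norm_exp]
  simp

theorem norm_exp_mul_evolution_le (V : BoundedContinuousFunction ℤ ℝ) (z : ℂ) (t : ℝ) (n : ℤ) :
    ‖Complex.exp (Complex.I * z * t) * evolution V t n‖ ≤ Real.exp (-z.im * t) := by
  rw [norm_mul, norm_exp_I_mul]
  exact mul_le_of_le_one_right (Real.exp_pos _).le (norm_evolution_apply_le V t n)

theorem integrableOn_exp_mul_evolution (V : BoundedContinuousFunction ℤ ℝ) {z : ℂ}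
    (hz : 0 < z.im) (n : ℤ) :
    IntegrableOn (fun t : ℝ => Complex.exp (Complex.I * z * t) * evolution V t n)
      (Set.Ioi 0) := by
  refine Integrable.mono' (g := fun t => Real.exp (-z.im * t))
    (exp_neg_integrableOn_Ioi 0 hz) ?_ (Eventually.of_forall fun t => ?_)
  · refine Continuous.aestronglyMeasurable ?_
    have := continuous_evolution_apply V n
    fun_prop
  · exact norm_exp_mul_evolution_le V z t n

/-- Integrate the derivative of e^{izt}ψ(t,n) over (0,∞): the boundary term at infinity vanishes
because Im z > 0, and the one at 0 is the initial state. -/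
theorem green_equation (V : BoundedContinuousFunction ℤ ℝ) {z : ℂ} (hz : 0 < z.im) (n : ℤ) :
    green V z (n - 1) + green V z (n + 1) + ((V n : ℂ) - z) * green V z n
      = -Complex.I * delta 1 n := by
  set φ : ℤ → ℝ → ℂ := fun n t => Complex.exp (Complex.I * z * t) * evolution V t n with hφ
  have hi : ∀ n, IntegrableOn (φ n) (Set.Ioi 0) := integrableOn_exp_mul_evolution V hz
  have hderiv : ∀ t ∈ Set.Ici (0 : ℝ), HasDerivAt (φ n)
      (-Complex.I * (φ (n - 1) t + φ (n + 1) t + ((V n : ℂ) - z) * φ n t)) t := by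
    intro t _
    have h0 : HasDerivAt (fun s : ℝ => Complex.exp (Complex.I * z * s))
        (Complex.exp (Complex.I * z * t) * (Complex.I * z * 1)) t :=
      ((Complex.ofRealCLM.hasDerivAt (x := t)).const_mul (Complex.I * z)).cexp
    refine (h0.mul (hasDerivAt_evolution_apply V t n)).congr_deriv ?_
    simp only [hφ]
    ring
  have hint : IntegrableOn
      (fun t => -Complex.I * (φ (n - 1) t + φ (n + 1) t + ((V n : ℂ) - z) * φ n t))
      (Set.Ioi 0) :=
    (((hi _).add (hi _)).add ((hi _).const_mul _)).const_mul _
  have hlim : Tendsto (φ n) atTop (nhds 0) := by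
    refine squeeze_zero_norm (fun t => norm_exp_mul_evolution_le V z t n) ?_
    refine Real.tendsto_exp_atBot.comp ?_
    exact tendsto_id.const_mul_atTop_of_neg (by linarith)
  have key := integral_Ioi_of_hasDerivAt_of_tendsto' hderiv hint hlim
  have h0 : φ n 0 = delta 1 n := by simp [hφ, evolution_zero]
  have hadd := integral_add ((hi (n - 1)).add (hi (n + 1))) ((hi n).const_mul ((V n : ℂ) - z))
  simp only [Pi.add_apply] at hadd
  rw [integral_const_mul, hadd, integral_add (hi _) (hi _), integral_const_mul, h0] at key
  have key' : -Complex.I * (green V z (n - 1) + green V z (n + 1)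
      + ((V n : ℂ) - z) * green V z n) = 0 - delta 1 n := key
  linear_combination Complex.I * key' + (green V z (n - 1) + green V z (n + 1)
      + ((V n : ℂ) - z) * green V z n) * Complex.I_sq

theorem inner_delta_evolution (V : BoundedContinuousFunction ℤ ℝ) (n : ℤ) (t : ℝ) :
    inner ℂ (delta n) (evolution V t) = evolution V t n := by
  rw [delta, lp.inner_single_left]
  simp

/-- Cauchy–Schwarz for the weight e^{-2t/T}, of total mass T/2. The imaginary part 2/T makes
|e^{izt}| equal to the weight in `avgProb`. No integration over energies is needed. -/
theorem norm_green_sq_le (V : BoundedContinuousFunction ℤ ℝ) (E : ℝ) {T : ℝ} (hT : 0 < T)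
    (n : ℤ) :
    2 / T ^ 2 * ‖green V (E + (2 / T : ℝ) * Complex.I) n‖ ^ 2 ≤ avgProb V n T := by
  set z : ℂ := E + (2 / T : ℝ) * Complex.I with hz
  have him : z.im = 2 / T := by simp [hz]
  have hpos : 0 < 2 / T := by positivity
  set w : ℝ → ℝ := fun t => Real.exp (-(2 / T) * t) with hw
  set f : ℝ → ℝ := fun t => ‖evolution V t n‖ with hf
  have hfc : Continuous f := (continuous_evolution_apply V n).norm
  have hf1 : ∀ t, ‖f t‖ ≤ 1 := fun t => by
    rw [hf, norm_norm]
    exact norm_evolution_apply_le V t n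
  have hwi : IntegrableOn w (Set.Ioi 0) := exp_neg_integrableOn_Ioi 0 hpos
  have hw0 : ∫ t in Set.Ioi (0 : ℝ), w t = T / 2 := by
    have := integral_exp_mul_Ioi (a := -(2 / T)) (by linarith) 0
    simp only [hw, this]
    simp
  have h1 : IntegrableOn (fun t => w t * f t) (Set.Ioi 0) :=
    Integrable.mul_bdd (c := 1) hwi hfc.aestronglyMeasurable (Eventually.of_forall hf1)
  have h2 : IntegrableOn (fun t => w t * f t ^ 2) (Set.Ioi 0) := by
    refine Integrable.mul_bdd (c := 1) hwi (hfc.pow 2).aestronglyMeasurable (Eventually.of_forall fun t => ?_)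
    rw [norm_pow]
    exact pow_le_one₀ (norm_nonneg _) (hf1 t)
  set I1 := ∫ t in Set.Ioi (0 : ℝ), w t * f t with hI1
  set I2 := ∫ t in Set.Ioi (0 : ℝ), w t * f t ^ 2 with hI2
  have hg : ‖green V z n‖ ≤ I1 := by
    refine (norm_integral_le_integral_norm _).trans_eq ?_
    refine integral_congr_ae (Eventually.of_forall fun t => ?_)
    simp only [norm_mul, norm_exp_I_mul, him, hw, hf]
  -- The weighted variance of `f` is nonnegative; `2 / T * I1` is its weighted mean.
  have hcs : 0 ≤ I2 - 2 * (2 / T * I1) * I1 + (2 / T * I1) ^ 2 * (T / 2) := by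
    have e : ∫ t in Set.Ioi (0 : ℝ), w t * (f t - 2 / T * I1) ^ 2
        = I2 - 2 * (2 / T * I1) * I1 + (2 / T * I1) ^ 2 * (T / 2) := by
      have : ∀ t, w t * (f t - 2 / T * I1) ^ 2 = w t * f t ^ 2
          - 2 * (2 / T * I1) * (w t * f t) + (2 / T * I1) ^ 2 * w t := fun t => by ring
      simp_rw [this]
      have hadd := integral_add (h2.sub (h1.const_mul (2 * (2 / T * I1))))
        (hwi.const_mul ((2 / T * I1) ^ 2))
      simp only [Pi.sub_apply] at hadd
      rw [hadd, integral_sub h2 (h1.const_mul _), integral_const_mul, integral_const_mul, hw0]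
    rw [← e]
    refine integral_nonneg fun t => ?_
    have := Real.exp_pos (-(2 / T) * t)
    positivity
  have hcs' : 2 / T * I1 ^ 2 ≤ I2 := by
    have : (2 / T * I1) ^ 2 * (T / 2) = 2 / T * I1 ^ 2 := by field_simp
    nlinarith
  have ha : avgProb V n T = 1 / T * I2 := by
    rw [avgProb, hI2]
    congr 1
    refine integral_congr_ae (Eventually.of_forall fun t => ?_)
    simp only [inner_delta_evolution, hw, hf]
    congr 2
    ring
  rw [ha]
  calc 2 / T ^ 2 * ‖green V z n‖ ^ 2 ≤ 2 / T ^ 2 * I1 ^ 2 := by gcongr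
    _ = 1 / T * (2 / T * I1 ^ 2) := by ring
    _ ≤ 1 / T * I2 := by gcongr

/-! ## Products of matrices and their perturbation -/

/-- The product `A (n-1) * ... * A 1 * A 0`. -/
def cocycle {R : Type*} [Monoid R] (A : ℕ → R) : ℕ → R
  | 0 => 1
  | n + 1 => A n * cocycle A n

theorem cocycle_add {R : Type*} [Monoid R] (A : ℕ → R) (i n : ℕ) :
    cocycle A (i + n) = cocycle (fun k => A (i + k)) n * cocycle A i := by
  induction n with
  | zero => simp [cocycle]
  | succ n ih => rw [← add_assoc, cocycle, ih, cocycle, mul_assoc]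

theorem cocycle_congr {R : Type*} [Monoid R] {A B : ℕ → R} {n : ℕ}
    (h : ∀ k < n, A k = B k) : cocycle A n = cocycle B n := by
  induction n with
  | zero => rfl
  | succ n ih =>
    rw [cocycle, cocycle, h n (Nat.lt_succ_self n), ih fun k hk => h k (hk.trans (Nat.lt_succ_self n))]

theorem norm_cocycle_add_le {R : Type*} [NormedRing R] (A D : ℕ → R) {N : ℕ} {K ε : ℝ}
    (hK : ∀ i n, i + n ≤ N → ‖cocycle (fun k => A (i + k)) n‖ ≤ K)
    (hD : ∀ k, ‖D k‖ ≤ ε) {n : ℕ} (hn : n ≤ N) :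
    ‖cocycle (fun k => A k + D k) n‖ ≤ K * (1 + ε * K) ^ n := by
  have hK0 : 0 ≤ K := (norm_nonneg _).trans (hK 0 0 (Nat.zero_le _))
  have hε : 0 ≤ ε := (norm_nonneg _).trans (hD 0)
  -- Induct over hybrid products: `k` perturbed factors followed by `n` unperturbed ones. The bound
  -- `K` then applies to whole unperturbed stretches, so each new perturbation costs only a factor
  -- `1 + ε * K`.
  have key : ∀ k n, k + n ≤ N →
      ‖cocycle (fun j => A (k + j)) n * cocycle (fun k => A k + D k) k‖ ≤ K * (1 + ε * K) ^ k := by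
    intro k
    induction k with
    | zero =>
      intro n hn
      simpa [cocycle] using hK 0 n hn
    | succ k ih =>
      intro n hn
      have h1 := ih (n + 1) (by omega)
      have h2 := ih 0 (by omega)
      have h3 := hK (k + 1) n hn
      simp only [cocycle, one_mul] at h2
      have e : cocycle (fun j => A (k + j)) (n + 1)
          = cocycle (fun j => A (k + 1 + j)) n * A k := by
        rw [add_comm n 1, cocycle_add]
        simp [cocycle, add_assoc]
      have e2 : cocycle (fun j => A (k + 1 + j)) n * cocycle (fun k => A k + D k) (k + 1)
          = cocycle (fun j => A (k + j)) (n + 1) * cocycle (fun k => A k + D k) k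
            + cocycle (fun j => A (k + 1 + j)) n * D k * cocycle (fun k => A k + D k) k := by
        rw [e, cocycle]
        noncomm_ring
      rw [e2]
      calc _ ≤ K * (1 + ε * K) ^ k + K * ε * (K * (1 + ε * K) ^ k) := by
            refine (norm_add_le _ _).trans (add_le_add h1 ?_)
            refine (norm_mul_le _ _).trans ?_
            refine mul_le_mul ((norm_mul_le _ _).trans ?_) h2 (norm_nonneg _) (by positivity)
            exact mul_le_mul h3 (hD k) (norm_nonneg _) hK0
        _ = K * (1 + ε * K) ^ (k + 1) := by ring
  simpa [cocycle] using key n 0 (by omega)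

attribute [local instance] Matrix.linftyOpNormedRing

theorem norm_fin_two_le {A : Matrix (Fin 2) (Fin 2) ℂ} {r : ℝ}
    (h0 : ‖A 0 0‖ + ‖A 0 1‖ ≤ r) (h1 : ‖A 1 0‖ + ‖A 1 1‖ ≤ r) : ‖A‖ ≤ r := by
  have hr : 0 ≤ r := (by positivity : (0 : ℝ) ≤ ‖A 0 0‖ + ‖A 0 1‖).trans h0
  lift r to NNReal using hr
  rw [Matrix.linfty_opNorm_def, NNReal.coe_le_coe, Finset.sup_le_iff]
  intro i _
  rw [Fin.sum_univ_two, ← NNReal.coe_le_coe]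
  fin_cases i
  · exact h0
  · exact h1

theorem norm_row_le (A : Matrix (Fin 2) (Fin 2) ℂ) (i : Fin 2) :
    ‖A i 0‖ + ‖A i 1‖ ≤ ‖A‖ := by
  have h : ∑ j, ‖A i j‖₊ ≤ Finset.univ.sup fun i => ∑ j, ‖A i j‖₊ :=
    Finset.le_sup (f := fun i => ∑ j, ‖A i j‖₊) (Finset.mem_univ i)
  rw [← NNReal.coe_le_coe, ← Matrix.linfty_opNorm_def, Fin.sum_univ_two] at h
  exact h

/-- In determinant one the adjugate is the inverse, so upper bounds on transfer matrices become
lower bounds on solutions. The 2 appears because a row of the adjugate mixes entries from both rows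
of `A`. -/
theorem norm_adjugate_le (A : Matrix (Fin 2) (Fin 2) ℂ) : ‖A.adjugate‖ ≤ 2 * ‖A‖ := by
  have h0 := norm_row_le A 0
  have h1 := norm_row_le A 1
  have := norm_nonneg (A 0 0)
  have := norm_nonneg (A 0 1)
  have := norm_nonneg (A 1 0)
  have := norm_nonneg (A 1 1)
  rw [Matrix.adjugate_fin_two]
  apply norm_fin_two_le <;> simp <;> linarith

/-- The one-step transfer matrix at a complex energy. -/
def step (x : ℝ) (z : ℂ) : Matrix (Fin 2) (Fin 2) ℂ :=
  !![z - x, -1; 1, 0]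

theorem det_cocycle_step (v : ℕ → ℝ) (z : ℂ) (n : ℕ) :
    (cocycle (fun k => step (v k) z) n).det = 1 := by
  induction n with
  | zero => simp [cocycle]
  | succ n ih => rw [cocycle, Matrix.det_mul, ih, step]; simp

/-- Polynomial bounds on transfer matrices at a real energy `E` persist at complex energies `z`
as long as `|z - E|` times the bound times the length of the product stays bounded. -/
theorem norm_cocycle_step_le (v : ℕ → ℝ) (E : ℝ) (z : ℂ) {N : ℕ} {K : ℝ}
    (hK : ∀ i n, i + n ≤ N → ‖cocycle (fun k => step (v (i + k)) E) n‖ ≤ K) {n : ℕ}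
    (hn : n ≤ N) :
    ‖cocycle (fun k => step (v k) z) n‖ ≤ K * Real.exp (‖z - E‖ * K * N) := by
  have hK0 : 0 ≤ K := (norm_nonneg _).trans (hK 0 0 (Nat.zero_le _))
  have e : ∀ k, step (v k) z = step (v k) E + !![z - E, 0; 0, 0] := fun k => by
    simp only [step]
    ext i j
    fin_cases i <;> fin_cases j <;> simp
  have hD : ‖(!![z - E, 0; 0, 0] : Matrix (Fin 2) (Fin 2) ℂ)‖ ≤ ‖z - E‖ := by
    apply norm_fin_two_le <;> simp
  simp_rw [e]
  refine (norm_cocycle_add_le (fun k => step (v k) E) (fun _ => !![z - E, 0; 0, 0]) hK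
    (fun _ => hD) hn).trans ?_
  refine mul_le_mul_of_nonneg_left ?_ hK0
  calc (1 + ‖z - E‖ * K) ^ n ≤ Real.exp (‖z - E‖ * K) ^ n := by
        gcongr
        rw [add_comm]
        exact Real.add_one_le_exp _
    _ = Real.exp (‖z - E‖ * K * n) := by rw [← Real.exp_nat_mul]; ring_nf
    _ ≤ _ := by gcongr

/-! ## Lower bounds for solutions -/

/-- The recurrence is assumed only on the stretch crossed, because `green` is a homogeneous solution
only away from site 1. -/
theorem solution_eq_cocycle_mulVec (V : ℤ → ℝ) (z : ℂ) (g : ℤ → ℂ) (i : ℤ) (n : ℕ)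
    (h : ∀ k : ℕ, k < n →
      g (i + k) + g (i + k + 2) + ((V (i + 1 + k) : ℂ) - z) * g (i + k + 1) = 0) :
    ![g (i + n + 1), g (i + n)]
      = (cocycle (fun k => step (V (i + 1 + k)) z) n).mulVec ![g (i + 1), g i] := by
  induction n with
  | zero => simp [cocycle]
  | succ n ih =>
    have hn := h n (Nat.lt_succ_self n)
    rw [cocycle, ← Matrix.mulVec_mulVec, ← ih fun k hk => h k (by omega)]
    have e : i + (n + 1 : ℕ) = i + n + 1 := by push_cast; ring
    rw [e, show i + n + 1 + 1 = i + n + 2 by ring]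
    ext j
    fin_cases j
    · simp [step, Matrix.mulVec, dotProduct]
      linear_combination hn
    · simp [step, Matrix.mulVec, dotProduct]

theorem norm_vec_two_sq_le (x y : ℂ) : ‖![x, y]‖ ^ 2 ≤ ‖x‖ ^ 2 + ‖y‖ ^ 2 := by
  have h : ‖![x, y]‖ ≤ Real.sqrt (‖x‖ ^ 2 + ‖y‖ ^ 2) := by
    rw [pi_norm_le_iff_of_nonneg (Real.sqrt_nonneg _)]
    intro i
    fin_cases i
    · exact Real.le_sqrt_of_sq_le (by simp)
    · exact Real.le_sqrt_of_sq_le (by simp)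
  calc ‖![x, y]‖ ^ 2 ≤ Real.sqrt (‖x‖ ^ 2 + ‖y‖ ^ 2) ^ 2 := by gcongr
    _ = _ := Real.sq_sqrt (by positivity)

/-- The equation at site 1 has a source of size 1, so one of the pairs (g 2, g 1), (g 1, g 0) has
norm at least 1/D. The first propagates homogeneously to the right, the second to the left; which
one is large is not known, hence the disjunction. -/
theorem green_lower_bound (V : BoundedContinuousFunction ℤ ℝ) {z : ℂ} (hz : 0 < z.im) {N : ℕ}
    {K : ℝ} (hK0 : 0 < K)
    (hK : ∀ (i : ℤ) (n : ℕ), n ≤ N → ‖cocycle (fun k => step (V (i + k)) z) n‖ ≤ K) :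
    (∀ n ≤ N, (1 / (2 * K * (2 + ‖V‖ + ‖z‖))) ^ 2
      ≤ ‖green V z (1 + n + 1)‖ ^ 2 + ‖green V z (1 + n)‖ ^ 2) ∨
    (∀ n ≤ N, (1 / (2 * K * (2 + ‖V‖ + ‖z‖))) ^ 2
      ≤ ‖green V z (-n + 1)‖ ^ 2 + ‖green V z (-n)‖ ^ 2) := by
  set g := green V z with hg
  have heq := green_equation V hz
  have hne : ∀ k : ℤ, k ≠ 0 → g k + g (k + 2) + ((V (k + 1) : ℂ) - z) * g (k + 1) = 0 := by
    intro k hk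
    have h := heq (k + 1)
    have hd : delta 1 (k + 1) = 0 := by
      rw [delta, lp.coeFn_single, Pi.single_eq_of_ne (by omega)]
    rw [hd, mul_zero, add_sub_cancel_right, show k + 1 + 1 = k + 2 by ring] at h
    exact h
  have h1 : g 0 + g 2 + ((V 1 : ℂ) - z) * g 1 = -Complex.I := by
    have h := heq 1
    have hd : delta 1 1 = 1 := by
      rw [delta, lp.coeFn_single, Pi.single_eq_same]
    rw [hd, mul_one] at h
    exact h
  set D := 2 + ‖V‖ + ‖z‖ with hD
  have hD0 : 0 < D := by positivity
  have hmain : 1 / D ≤ ‖![g 2, g 1]‖ ∨ 1 / D ≤ ‖![g 1, g 0]‖ := by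
    by_contra! hcon
    have a0 : ‖g 0‖ < 1 / D := (norm_le_pi_norm ![g 1, g 0] 1).trans_lt hcon.2
    have a1 : ‖g 1‖ < 1 / D := (norm_le_pi_norm ![g 1, g 0] 0).trans_lt hcon.2
    have a2 : ‖g 2‖ < 1 / D := (norm_le_pi_norm ![g 2, g 1] 0).trans_lt hcon.1
    have hV : ‖(V 1 : ℂ) - z‖ ≤ ‖V‖ + ‖z‖ := by
      refine (norm_sub_le _ _).trans ?_
      rw [Complex.norm_real]
      gcongr
      exact V.norm_coe_le_norm 1
    have : (1 : ℝ) < 1 := by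
      calc (1 : ℝ) = ‖g 0 + g 2 + ((V 1 : ℂ) - z) * g 1‖ := by rw [h1]; simp
        _ ≤ ‖g 0‖ + ‖g 2‖ + (‖V‖ + ‖z‖) * ‖g 1‖ := by
          refine (norm_add_le _ _).trans ?_
          gcongr
          · exact norm_add_le _ _
          · rw [norm_mul]
            gcongr
        _ < 1 / D + 1 / D + (‖V‖ + ‖z‖) * (1 / D) := by
          have : (‖V‖ + ‖z‖) * ‖g 1‖ ≤ (‖V‖ + ‖z‖) * (1 / D) := by gcongr
          linarith
        _ = D * (1 / D) := by rw [hD]; ring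
        _ = 1 := by field_simp
    exact lt_irrefl _ this
  have hsq : ∀ (x y : ℂ), 1 / D ≤ 2 * K * ‖![x, y]‖ →
      (1 / (2 * K * D)) ^ 2 ≤ ‖x‖ ^ 2 + ‖y‖ ^ 2 := by
    intro x y h
    refine le_trans ?_ (norm_vec_two_sq_le x y)
    have : 1 / (2 * K * D) ≤ ‖![x, y]‖ := by
      rw [div_le_iff₀ (by positivity)] at h ⊢
      linarith
    gcongr
  refine hmain.imp (fun h n hn => hsq _ _ (h.trans ?_)) (fun h n hn => hsq _ _ (h.trans ?_))
  -- On the right the initial pair is recovered from the distant one by the inverse transfer matrix.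
  · have hs := solution_eq_cocycle_mulVec V z g 1 n fun k _ => by
      have := hne (1 + k) (by omega)
      rwa [show (1 : ℤ) + k + 1 = 1 + 1 + k by ring] at this ⊢
    have hP := hK (1 + 1) n hn
    set P := cocycle (fun k => step (V (1 + 1 + k)) z) n with hPdef
    have hdet : P.det = 1 := det_cocycle_step _ _ _
    have hinv : ![g 2, g 1] = P.adjugate.mulVec ![g (1 + n + 1), g (1 + n)] := by
      rw [hs, Matrix.mulVec_mulVec, Matrix.adjugate_mul, hdet, one_smul, Matrix.one_mulVec]
      norm_num
    rw [hinv]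
    refine (Matrix.linfty_opNorm_mulVec _ _).trans ?_
    gcongr
    exact (norm_adjugate_le P).trans (by gcongr)
  -- On the left the distant pair is carried forward to site 0, so no inverse is needed.
  · have hs := solution_eq_cocycle_mulVec V z g (-n) n fun k hk => by
      have := hne (-n + k) (by omega)
      rwa [show (-n : ℤ) + k + 1 = -n + 1 + k by ring] at this ⊢
    rw [neg_add_cancel, zero_add] at hs
    rw [hs]
    refine (Matrix.linfty_opNorm_mulVec _ _).trans ?_
    have := hK (-n + 1) n hn
    gcongr
    linarith

/-! ## Lower bounds for the transport exponents -/

theorem le_betaMinus_of_moment (V : BoundedContinuousFunction ℤ ℝ) {p β c : ℝ} (hc : 0 < c)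
    (h : ∀ T : ℝ, 1 ≤ T → ENNReal.ofReal (c * T ^ β) ≤ 2 * moment V p T) :
    (β : EReal) ≤ betaMinus V p := by
  have hlim : Tendsto (fun T : ℝ => ((Real.log (c / 2) / Real.log T + β : ℝ) : EReal)) atTop
      (nhds (β : EReal)) := by
    refine (continuous_coe_real_ereal.tendsto β).comp ?_
    have := (tendsto_const_nhds (x := Real.log (c / 2))).div_atTop Real.tendsto_log_atTop
    simpa using this.add_const β
  rw [← hlim.liminf_eq]
  refine liminf_le_liminf ?_
  filter_upwards [eventually_gt_atTop 1] with T hT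
  have hT0 : 0 < T := by linarith
  have hlog : 0 < Real.log T := Real.log_pos hT
  have hm : ENNReal.ofReal (c / 2 * T ^ β) ≤ moment V p T := by
    have h2 := h T hT.le
    rw [show c * T ^ β = 2 * (c / 2 * T ^ β) by ring, ENNReal.ofReal_mul (by norm_num),
      ENNReal.ofReal_ofNat] at h2
    exact (ENNReal.mul_le_mul_iff_right (by norm_num) (by norm_num)).1 h2
  have hl := ENNReal.log_le_log hm
  rw [ENNReal.log_ofReal_of_pos (by positivity)] at hl
  refine le_trans (le_of_eq ?_)
    (EReal.div_le_div_right_of_nonneg (EReal.coe_nonneg.2 hlog.le) hl)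
  rw [← EReal.coe_div, Real.log_mul (by positivity) (by positivity), Real.log_rpow hT0, add_div,
    mul_div_cancel_right₀ _ hlog.ne']

theorem avgProb_nonneg (V : BoundedContinuousFunction ℤ ℝ) (n : ℤ) {T : ℝ} (hT : 0 < T) :
    0 ≤ avgProb V n T :=
  mul_nonneg (by positivity) (integral_nonneg fun t => by positivity)

/-- Lower bounds are known only for pairs of neighbouring sites. Consecutive pairs overlap, so a
site may be counted twice; this is the factor 2. -/
theorem ofReal_mul_le_two_mul_moment (V : BoundedContinuousFunction ℤ ℝ) {p T x : ℝ} (hT : 0 < T)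
    (N : ℕ) {e e' : ℕ → ℤ} (he : Function.Injective e) (he' : Function.Injective e')
    (h : ∀ k < N, x ≤ |(e k : ℝ)| ^ p * avgProb V (e k) T + |(e' k : ℝ)| ^ p * avgProb V (e' k) T) :
    ENNReal.ofReal (N * x) ≤ 2 * moment V p T := by
  set F : ℤ → ℝ≥0∞ := fun n => ENNReal.ofReal (|(n : ℝ)| ^ p * avgProb V n T) with hF
  have hsum : ∀ f : ℕ → ℤ, Function.Injective f →
      ∑ k ∈ Finset.range N, F (f k) ≤ moment V p T := fun f hf =>
    (ENNReal.sum_le_tsum _).trans (ENNReal.tsum_comp_le_tsum_of_injective hf F)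
  calc ENNReal.ofReal (N * x) = ∑ k ∈ Finset.range N, ENNReal.ofReal x := by
        rw [Finset.sum_const, Finset.card_range, nsmul_eq_mul,
          ENNReal.ofReal_mul (Nat.cast_nonneg _), ENNReal.ofReal_natCast]
    _ ≤ ∑ k ∈ Finset.range N, (F (e k) + F (e' k)) := by
        refine Finset.sum_le_sum fun k hk => ?_
        rw [hF, ← ENNReal.ofReal_add]
        · exact ENNReal.ofReal_le_ofReal (h k (Finset.mem_range.1 hk))
        · exact mul_nonneg (by positivity) (avgProb_nonneg V _ hT)
        · exact mul_nonneg (by positivity) (avgProb_nonneg V _ hT)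
    _ ≤ moment V p T + moment V p T := by
        rw [Finset.sum_add_distrib]
        exact add_le_add (hsum e he) (hsum e' he')
    _ = 2 * moment V p T := (two_mul _).symm

theorem rpow_mul_green_le (V : BoundedContinuousFunction ℤ ℝ) (E : ℝ) {p T : ℝ} (hp : 0 < p)
    (hT : 0 < T) {N : ℕ} {n : ℤ} (hn : (N : ℝ) ≤ |(n : ℝ)|) :
    (N : ℝ) ^ p * (2 / T ^ 2 * ‖green V (E + (2 / T : ℝ) * Complex.I) n‖ ^ 2)
      ≤ |(n : ℝ)| ^ p * avgProb V n T :=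
  mul_le_mul (Real.rpow_le_rpow (Nat.cast_nonneg _) hn hp.le) (norm_green_sq_le V E hT n)
    (by positivity) (by positivity)

/-- Power-law bounds on the transfer matrices at a single real energy imply lower bounds on the
transport exponents. -/
theorem le_betaMinus_of_norm_cocycle_le (V : BoundedContinuousFunction ℤ ℝ) (E : ℝ) {α C : ℝ}
    (hα : 0 ≤ α) (h : ∀ (i : ℤ) (n : ℕ),
      ‖cocycle (fun k => step (V (i + k)) E) n‖ ≤ C * ((n : ℝ) + 1) ^ α) {p : ℝ} (hp : 0 < p) :
    (((p - 1 - 4 * α) / (1 + α) : ℝ) : EReal) ≤ betaMinus V p := by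
  have hC : 0 < C := by
    have := h 0 0
    have h1 : (0 : ℝ) < ‖(1 : Matrix (Fin 2) (Fin 2) ℂ)‖ := norm_pos_iff.2 one_ne_zero
    simp only [cocycle, Nat.cast_zero, zero_add, Real.one_rpow, mul_one] at this
    exact h1.trans_le this
  -- This exponent balances |z - E| ~ 1/T against (transfer bound) × (length) ~ T^(γα + γ).
  set γ := 1 / (1 + α) with hγ
  -- Constants below: lengths reach at most 2N + 1 ≤ 5T^γ, so l + 1 ≤ 6T^γ gives the 6 in `C1`; in
  -- `C2` the 2 is that of |z - E| = 2/T and the 5 bounds the length.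
  have hα1 : 0 < 1 + α := by linarith
  have hγ0 : 0 < γ := by positivity
  have hγα : γ * α + γ = 1 := by rw [hγ]; field_simp; ring
  set C1 := C * 6 ^ α with hC1
  have hC1' : 0 < C1 := by positivity
  set C2 := C1 * Real.exp (2 * C1 * 5) with hC2
  have hC2' : 0 < C2 := by positivity
  set D := 2 + ‖V‖ + (|E| + 2) with hD
  have hD' : 0 < D := by positivity
  refine le_betaMinus_of_moment V (c := 2 * (1 / (2 * C2 * D)) ^ 2) (by positivity) fun T hT => ?_
  have hT0 : 0 < T := by linarith
  set N := ⌈T ^ γ⌉₊ with hN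
  have hTγ : 1 ≤ T ^ γ := Real.one_le_rpow hT hγ0.le
  have hN1 : T ^ γ ≤ N := Nat.le_ceil _
  have hN2 : (N : ℝ) ≤ 2 * T ^ γ := by
    have := Nat.ceil_lt_add_one (zero_le_one.trans hTγ)
    linarith
  have hN0 : (0 : ℝ) < N := by linarith
  set z : ℂ := E + (2 / T : ℝ) * Complex.I with hz
  have hzE : ‖z - E‖ = 2 / T := by
    rw [hz, add_sub_cancel_left, norm_mul, Complex.norm_real, Complex.norm_I, mul_one,
      Real.norm_of_nonneg (by positivity)]
  have hznorm : ‖z‖ ≤ |E| + 2 := by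
    calc ‖z‖ = ‖(E : ℂ) + (z - E)‖ := by rw [add_sub_cancel]
      _ ≤ |E| + 2 / T := by
        refine (norm_add_le _ _).trans_eq ?_
        rw [hzE, Complex.norm_real, Real.norm_eq_abs]
      _ ≤ |E| + 2 := by
        gcongr
        exact div_le_self (by norm_num) hT
  set K := C2 * T ^ (γ * α) with hK
  have hTp : 0 < T ^ (γ * α) := by positivity
  have hbound : ∀ (i : ℤ) (n : ℕ), n ≤ 2 * N + 1 →
      ‖cocycle (fun k => step (V (i + k)) z) n‖ ≤ K := by
    intro i n hn
    refine (norm_cocycle_step_le (fun k : ℕ => V (i + k)) E z (N := 2 * N + 1)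
      (K := C1 * T ^ (γ * α)) (fun j l hjl => ?_) hn).trans ?_
    · have := h (i + j) l
      simp only [Nat.cast_add, ← add_assoc]
      refine this.trans ?_
      have hl : (l : ℝ) + 1 ≤ 6 * T ^ γ := by
        have : l ≤ 2 * N + 1 := by omega
        have : (l : ℝ) ≤ 2 * N + 1 := by exact_mod_cast this
        linarith
      calc C * ((l : ℝ) + 1) ^ α ≤ C * (6 * T ^ γ) ^ α := by gcongr
        _ = C1 * T ^ (γ * α) := by
          rw [Real.mul_rpow (by norm_num) (by positivity), ← Real.rpow_mul hT0.le, hC1]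
          ring
    · have : ‖z - E‖ * (C1 * T ^ (γ * α)) * ((2 * N + 1 : ℕ) : ℝ) ≤ 2 * C1 * 5 := by
        have h5 : ((2 * N + 1 : ℕ) : ℝ) ≤ 5 * T ^ γ := by push_cast; linarith
        calc ‖z - E‖ * (C1 * T ^ (γ * α)) * ((2 * N + 1 : ℕ) : ℝ)
            ≤ 2 / T * (C1 * T ^ (γ * α)) * (5 * T ^ γ) := by rw [hzE]; gcongr
          _ = 2 * C1 * 5 * (T ^ (γ * α) * T ^ γ / T) := by ring
          _ = 2 * C1 * 5 := by
            rw [← Real.rpow_add hT0, hγα, Real.rpow_one, div_self hT0.ne', mul_one]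
      rw [hK, hC2]
      calc C1 * T ^ (γ * α) * Real.exp _ ≤ C1 * T ^ (γ * α) * Real.exp (2 * C1 * 5) := by gcongr
        _ = _ := by ring
  have hzim : 0 < z.im := by
    have : z.im = 2 / T := by simp [hz]
    rw [this]
    positivity
  have hK0 : 0 < K := by positivity
  set c := 1 / (2 * K * D) with hc
  have hcle : c ^ 2 ≤ (1 / (2 * K * (2 + ‖V‖ + ‖z‖))) ^ 2 := by
    rw [hc, hD]
    gcongr
  set x := (N : ℝ) ^ p * (2 / T ^ 2 * c ^ 2) with hx
  have hmom : ENNReal.ofReal (N * x) ≤ 2 * moment V p T := by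
    have hpt : ∀ i j : ℤ, (N : ℝ) ≤ |(i : ℝ)| → (N : ℝ) ≤ |(j : ℝ)| →
        (1 / (2 * K * (2 + ‖V‖ + ‖z‖))) ^ 2 ≤ ‖green V z i‖ ^ 2 + ‖green V z j‖ ^ 2 →
        x ≤ |(i : ℝ)| ^ p * avgProb V i T + |(j : ℝ)| ^ p * avgProb V j T := by
      intro i j hi hj hij
      refine le_trans ?_ (add_le_add (rpow_mul_green_le V E hp hT0 hi)
        (rpow_mul_green_le V E hp hT0 hj))
      rw [← mul_add, ← mul_add]
      exact mul_le_mul_of_nonneg_left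
        (mul_le_mul_of_nonneg_left (hcle.trans hij) (by positivity)) (by positivity)
    rcases green_lower_bound V hzim hK0 hbound with hg | hg
    · refine ofReal_mul_le_two_mul_moment V hT0 N (e := fun k => 1 + (N + k : ℕ) + 1)
        (e' := fun k => 1 + (N + k : ℕ)) (fun i j hij => by simpa using hij)
        (fun i j hij => by simpa using hij) fun k hk => ?_
      refine hpt _ _ ?_ ?_ (hg (N + k) (by omega))
      · exact le_abs.2 (Or.inl (by push_cast; linarith [(Nat.cast_nonneg k : (0 : ℝ) ≤ k)]))
      · exact le_abs.2 (Or.inl (by push_cast; linarith [(Nat.cast_nonneg k : (0 : ℝ) ≤ k)]))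
    -- The shift by one keeps both sites of each pair at distance at least `N` from 0.
    · refine ofReal_mul_le_two_mul_moment V hT0 N (e := fun k => -((N + k + 1 : ℕ) : ℤ) + 1)
        (e' := fun k => -((N + k + 1 : ℕ) : ℤ)) (fun i j hij => by simpa using hij)
        (fun i j hij => by simpa using hij) fun k hk => ?_
      refine hpt _ _ ?_ ?_ (hg (N + k + 1) (by omega))
      · exact le_abs.2 (Or.inr (by push_cast; linarith [(Nat.cast_nonneg k : (0 : ℝ) ≤ k)]))
      · exact le_abs.2 (Or.inr (by push_cast; linarith [(Nat.cast_nonneg k : (0 : ℝ) ≤ k)]))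
  refine le_trans (ENNReal.ofReal_le_ofReal ?_) hmom
  have hexp : (p - 1 - 4 * α) / (1 + α) = γ + γ * p - 2 - (γ * α + γ * α) := by
    rw [hγ]; field_simp; ring
  calc 2 * (1 / (2 * C2 * D)) ^ 2 * T ^ ((p - 1 - 4 * α) / (1 + α))
      = T ^ γ * ((T ^ γ) ^ p * (2 / T ^ 2 * c ^ 2)) := by
        rw [hexp, Real.rpow_sub hT0, Real.rpow_sub hT0, Real.rpow_add hT0, Real.rpow_mul hT0.le,
          Real.rpow_add hT0, Real.rpow_two, hc, hK]
        field_simp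
    _ ≤ N * x := by
        rw [hx]
        gcongr

/-! ## Block structure of the fixed point -/

theorem length_substLetter (m n : ℕ) (c : Letter) : (substLetter m n c).length = m + n := by
  cases c <;> simp [substLetter, add_comm]

theorem getElem?_substWord (m n : ℕ) (w : List Letter) (q r : ℕ) (c : Letter)
    (hq : w[q]? = some c) (hr : r < m + n) :
    (substWord m n w)[q * (m + n) + r]? = (substLetter m n c)[r]? := by
  induction w generalizing q with
  | nil => simp at hq
  | cons d w ih =>
    have e : substWord m n (d :: w) = substLetter m n d ++ substWord m n w := rfl
    have hl := length_substLetter m n d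
    cases q with
    | zero =>
      obtain rfl : d = c := by simpa using hq
      rw [e, List.getElem?_append_left (by omega), zero_mul, zero_add]
    | succ q =>
      have hle : (substLetter m n d).length ≤ (q + 1) * (m + n) + r := by
        rw [hl, add_one_mul]
        omega
      rw [e, List.getElem?_append_right hle, ← ih q (by simpa using hq), hl]
      congr 1
      rw [add_one_mul]
      omega

/-- This is S(u) = u read blockwise: u_q already sits in S^q(a), so its image sits in S^{q+1}(a),
which is again a prefix of u. -/
theorem getElem?_substLetter_fixedPoint {m n : ℕ} (hm : 1 ≤ m) (hn : 1 ≤ n) (q r : ℕ)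
    (hr : r < m + n) :
    (substLetter m n (fixedPoint m n q))[r]? = some (fixedPoint m n (q * (m + n) + r)) := by
  have hq : q < (m + n) ^ q := Nat.lt_pow_self (by omega)
  have h1 := getElem?_iterWord m n q q hm hn (by rwa [length_iterWord])
  rw [← getElem?_substWord m n _ q r _ h1 hr, ← iterWord_succ]
  refine getElem?_iterWord m n (q + 1) _ hm hn ?_
  rw [length_iterWord, pow_succ]
  calc q * (m + n) + r < q * (m + n) + (m + n) := by omega
    _ = (q + 1) * (m + n) := by ring
    _ ≤ _ := Nat.mul_le_mul_right _ hq

theorem cocycle_const {R : Type*} [Monoid R] (A : R) (n : ℕ) : cocycle (fun _ => A) n = A ^ n := by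
  induction n with
  | zero => simp [cocycle]
  | succ n ih => rw [cocycle, ih, pow_succ']

theorem cocycle_append_const {R : Type*} [Monoid R] {f : ℕ → R} {x y : R} {k l : ℕ}
    (hx : ∀ r < k, f r = x) (hy : ∀ r < l, f (k + r) = y) :
    cocycle f (k + l) = y ^ l * x ^ k := by
  rw [cocycle_add, cocycle_congr hx, cocycle_congr hy, cocycle_const, cocycle_const]

theorem cocycle_fixedPoint_of_eq_a {R : Type*} [Monoid R] (s : Letter → R) {m n : ℕ}
    (hm : 1 ≤ m) (hn : 1 ≤ n) {q : ℕ} (hq : fixedPoint m n q = Letter.a) :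
    cocycle (fun k => s (fixedPoint m n (q * (m + n) + k))) (m + n)
      = s Letter.b ^ n * s Letter.a ^ m := by
  have h := getElem?_substLetter_fixedPoint hm hn q
  rw [hq] at h
  refine cocycle_append_const (fun r hr => ?_) (fun r hr => ?_)
  · have := h r (by omega)
    rw [substLetter, List.getElem?_append_left (by simpa using hr), List.getElem?_replicate,
      if_pos hr, Option.some_inj] at this
    rw [← this]
  · have := h (m + r) (by omega)
    rw [substLetter, List.getElem?_append_right (by simp), List.getElem?_replicate,
      if_pos (by simpa using hr), Option.some_inj] at this
    rw [← this]

theorem cocycle_fixedPoint_of_eq_b {R : Type*} [Monoid R] (s : Letter → R) {m n : ℕ}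
    (hm : 1 ≤ m) (hn : 1 ≤ n) {q : ℕ} (hq : fixedPoint m n q = Letter.b) :
    cocycle (fun k => s (fixedPoint m n (q * (m + n) + k))) (m + n)
      = s Letter.a ^ m * s Letter.b ^ n := by
  have h := getElem?_substLetter_fixedPoint hm hn q
  rw [hq] at h
  have e : cocycle (fun k => s (fixedPoint m n (q * (m + n) + k))) (n + m)
      = s Letter.a ^ m * s Letter.b ^ n := by
    refine cocycle_append_const (fun r hr => ?_) (fun r hr => ?_)
    · have := h r (by omega)
      rw [substLetter, List.getElem?_append_left (by simpa using hr), List.getElem?_replicate,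
        if_pos hr, Option.some_inj] at this
      rw [← this]
    · have := h (n + r) (by omega)
      rw [substLetter, List.getElem?_append_right (by simp), List.getElem?_replicate,
        if_pos (by simpa using hr), Option.some_inj] at this
      rw [← this]
  rwa [add_comm n m] at e

/-! ## Transfer matrices over sequences of resonant blocks -/

theorem norm_cocycle_le_pow {A : ℕ → Matrix (Fin 2) (Fin 2) ℂ} {D : ℝ}
    (hA : ∀ k, ‖A k‖ ≤ D) (n : ℕ) : ‖cocycle A n‖ ≤ D ^ n := by
  induction n with
  | zero => simp [cocycle]
  | succ n ih =>
    rw [cocycle, pow_succ']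
    exact (norm_mul_le _ _).trans
      (mul_le_mul (hA n) ih (norm_nonneg _) ((norm_nonneg _).trans (hA n)))

theorem cocycle_blocks {R : Type*} [Ring R] {A : ℕ → R} {B : R} {L : ℕ}
    (hblock : ∀ q, cocycle (fun k => A (q * L + k)) L = B ∨
      cocycle (fun k => A (q * L + k)) L = -B) (q₀ q : ℕ) :
    cocycle (fun k => A (q₀ * L + k)) (q * L) = B ^ q ∨
      cocycle (fun k => A (q₀ * L + k)) (q * L) = -B ^ q := by
  induction q with
  | zero => simp [cocycle]
  | succ q ih =>
    rw [add_one_mul, cocycle_add]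
    have e : cocycle (fun k => A (q₀ * L + (q * L + k))) L
        = cocycle (fun k => A ((q₀ + q) * L + k)) L := by
      simp only [add_mul, add_assoc]
    rw [e, pow_succ']
    rcases hblock (q₀ + q) with h | h <;> rcases ih with h' | h' <;> rw [h, h'] <;> simp

/-- Cut the stretch into a piece up to a block boundary, whole blocks with product ±B^q, and a tail.
The end pieces have at most `L` factors each; a stretch that ends before the boundary accounts for
the separate summand `D ^ L`. -/
theorem norm_cocycle_le_of_blocks {A : ℕ → Matrix (Fin 2) (Fin 2) ℂ}
    {B : Matrix (Fin 2) (Fin 2) ℂ} {L : ℕ} (hL : 1 ≤ L) {D C α : ℝ} (hD : 1 ≤ D) (hα : 0 ≤ α)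
    (hA : ∀ k, ‖A k‖ ≤ D)
    (hblock : ∀ q, cocycle (fun k => A (q * L + k)) L = B ∨
      cocycle (fun k => A (q * L + k)) L = -B)
    (hB : ∀ j : ℕ, ‖B ^ j‖ ≤ C * ((j : ℝ) + 1) ^ α) (i n : ℕ) :
    ‖cocycle (fun k => A (i + k)) n‖ ≤ (D ^ L + D ^ L * C * D ^ L) * ((n : ℝ) + 1) ^ α := by
  have hC : 0 ≤ C := by
    have := (norm_nonneg _).trans (hB 0)
    simpa using this
  have hone : 1 ≤ ((n : ℝ) + 1) ^ α :=
    Real.one_le_rpow (by linarith [(Nat.cast_nonneg n : (0 : ℝ) ≤ n)]) hα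
  have hshort : ∀ i r, r ≤ L → ‖cocycle (fun k => A (i + k)) r‖ ≤ D ^ L := fun i r hr =>
    (norm_cocycle_le_pow (fun k => hA _) r).trans (pow_le_pow_right₀ hD hr)
  have hDL : 0 ≤ D ^ L := by positivity
  rw [add_mul]
  -- If `L` divides `i`, the first piece is a full block, which is harmless.
  obtain hlt | ⟨l, rfl⟩ : n < L - i % L ∨ ∃ l, n = (L - i % L) + l := by
    rcases lt_or_ge n (L - i % L) with h | h
    · exact Or.inl h
    · exact Or.inr ⟨n - (L - i % L), by omega⟩
  · refine le_add_of_le_of_nonneg ?_ (by positivity)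
    exact (hshort i n (by omega)).trans (le_mul_of_one_le_right hDL hone)
  · refine le_add_of_nonneg_of_le (by positivity) ?_
    have hmod : i % L < L := Nat.mod_lt _ (by omega)
    have hi : i + (L - i % L) = (i / L + 1) * L := by
      have := Nat.div_add_mod i L
      rw [add_one_mul, mul_comm]
      omega
    have hl : l / L * L + l % L = l := Nat.div_add_mod' l L
    have e : cocycle (fun k => A (i + k)) (L - i % L + l)
        = cocycle (fun k => A ((i / L + 1) * L + l / L * L + k)) (l % L)
          * cocycle (fun k => A ((i / L + 1) * L + k)) (l / L * L)
          * cocycle (fun k => A (i + k)) (L - i % L) := by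
      rw [cocycle_add]
      simp only [← add_assoc, hi]
      nth_rewrite 1 [← hl]
      rw [cocycle_add]
      simp only [← add_assoc]
    have hmid : ‖cocycle (fun k => A ((i / L + 1) * L + k)) (l / L * L)‖
        ≤ C * (((L - i % L + l : ℕ) : ℝ) + 1) ^ α := by
      have h1 : ‖cocycle (fun k => A ((i / L + 1) * L + k)) (l / L * L)‖ = ‖B ^ (l / L)‖ := by
        rcases cocycle_blocks hblock (i / L + 1) (l / L) with h | h
        · rw [h]
        · rw [h, norm_neg]
      rw [h1]
      refine (hB _).trans ?_
      have : l / L ≤ L - i % L + l := (Nat.div_le_self l L).trans (by omega)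
      gcongr
    rw [e]
    calc _ ≤ D ^ L * (C * (((L - i % L + l : ℕ) : ℝ) + 1) ^ α) * D ^ L := by
          refine (norm_mul_le _ _).trans (mul_le_mul ((norm_mul_le _ _).trans ?_)
            (hshort _ _ (by omega)) (norm_nonneg _) (by positivity))
          exact mul_le_mul (hshort _ _ (Nat.mod_lt _ (by omega)).le) hmid (norm_nonneg _) hDL
      _ = _ := by ring

/-- Every finite word of ω occurs in u, so bounds along u that are uniform in the starting point
pass to all of ω. -/
theorem le_betaMinus_of_blocks {m n : ℕ} {a b E : ℝ} {ω : ℤ → Letter} (hω : ω ∈ subshift m n)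
    {B : Matrix (Fin 2) (Fin 2) ℂ} {L : ℕ} (hL : 1 ≤ L) {C α : ℝ} (hα : 0 ≤ α)
    (hblock : ∀ q, cocycle (fun k => step (letterValue a b (fixedPoint m n (q * L + k))) E) L = B ∨
      cocycle (fun k => step (letterValue a b (fixedPoint m n (q * L + k))) E) L = -B)
    (hB : ∀ j : ℕ, ‖B ^ j‖ ≤ C * ((j : ℝ) + 1) ^ α) {p : ℝ} (hp : 0 < p) :
    (((p - 1 - 4 * α) / (1 + α) : ℝ) : EReal) ≤ betaMinus (potential a b ω) p := by
  have hD : ∀ c, ‖step (letterValue a b c) E‖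
      ≤ max 1 (max ‖step a E‖ ‖step b E‖) := by
    rintro (_ | _) <;> simp [letterValue]
  obtain ⟨C', key⟩ : ∃ C', ∀ i l : ℕ,
      ‖cocycle (fun k => step (letterValue a b (fixedPoint m n (i + k))) E) l‖
        ≤ C' * ((l : ℝ) + 1) ^ α := ⟨_, norm_cocycle_le_of_blocks
    (A := fun k => step (letterValue a b (fixedPoint m n k)) E) hL (le_max_left 1 _) hα
    (fun k => hD _) hblock hB⟩
  refine le_betaMinus_of_norm_cocycle_le _ E (C := C') hα (fun i l => ?_) hp
  obtain ⟨j, hj⟩ := hω i l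
  have e : cocycle (fun k => step (potential a b ω (i + k)) E) l
      = cocycle (fun k => step (letterValue a b (fixedPoint m n (j + k))) E) l := by
    refine cocycle_congr fun k hk => ?_
    rw [← hj k hk]
    rfl
  rw [e]
  exact key j l

/-! ## Powers of elliptic and parabolic transfer matrices -/

theorem step_ofReal_pow (x E : ℝ) (j : ℕ) :
    step x E ^ j = Complex.ofRealHom.mapMatrix (transfer x E ^ j) := by
  rw [map_pow]
  congr 1
  ext i k
  fin_cases i <;> fin_cases k <;> simp [step, transfer]

theorem transfer_pow_succ_apply (x E : ℝ) (j : ℕ) (k : Fin 2) :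
    (transfer x E ^ (j + 1)) 0 k
        = (E - x) * (transfer x E ^ j) 0 k - (transfer x E ^ j) 1 k ∧
      (transfer x E ^ (j + 1)) 1 k = (transfer x E ^ j) 0 k := by
  rw [pow_succ', Matrix.mul_apply, Matrix.mul_apply, Fin.sum_univ_two, Fin.sum_univ_two]
  simp [transfer]
  ring

/-- The form u² - tuw + w², t = E - x, is invariant under the transfer matrix and, for |t| < 2,
bounded below by (1 - |t|/2)(u² + w²). Hence the columns of all powers stay bounded. -/
theorem exists_norm_step_pow_le_of_elliptic {x E : ℝ} (h : |E - x| < 2) :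
    ∃ C, ∀ j : ℕ, ‖step x E ^ j‖ ≤ C := by
  set t := E - x with ht
  have hQ : ∀ (j : ℕ) (k : Fin 2), (transfer x E ^ j) 0 k ^ 2
      - t * (transfer x E ^ j) 0 k * (transfer x E ^ j) 1 k + (transfer x E ^ j) 1 k ^ 2 = 1 := by
    intro j k
    induction j with
    | zero => fin_cases k <;> simp
    | succ j ih =>
      obtain ⟨h0, h1⟩ := transfer_pow_succ_apply x E j k
      rw [h0, h1, ← ih]
      ring
  set δ := 1 - |t| / 2 with hδ
  have hδ0 : 0 < δ := by linarith
  have hent : ∀ (j : ℕ) (k : Fin 2), ‖(transfer x E ^ j) 0 k‖ ≤ Real.sqrt (1 / δ) ∧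
      ‖(transfer x E ^ j) 1 k‖ ≤ Real.sqrt (1 / δ) := by
    intro j k
    have hq := hQ j k
    generalize (transfer x E ^ j) 0 k = u at hq ⊢
    generalize (transfer x E ^ j) 1 k = w at hq ⊢
    have h1 : t * u * w ≤ |t| / 2 * (u ^ 2 + w ^ 2) := by
      rcases abs_cases t with ⟨h, h'⟩ | ⟨h, h'⟩ <;> rw [h]
      · nlinarith [mul_nonneg h' (sq_nonneg (u - w))]
      · nlinarith [mul_nonneg (neg_nonneg.2 h'.le) (sq_nonneg (u + w))]
    have h2 : δ * (u ^ 2 + w ^ 2) ≤ 1 := by rw [hδ]; linarith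
    have h3 : u ^ 2 + w ^ 2 ≤ 1 / δ := by rw [le_div_iff₀ hδ0]; linarith
    exact ⟨Real.abs_le_sqrt (by nlinarith), Real.abs_le_sqrt (by nlinarith)⟩
  refine ⟨2 * Real.sqrt (1 / δ), fun j => ?_⟩
  rw [step_ofReal_pow]
  have h0 := hent j 0
  have h1 := hent j 1
  apply norm_fin_two_le <;>
    simp only [RingHom.mapMatrix_apply, Matrix.map_apply, Complex.ofRealHom_eq_coe,
      Complex.norm_real] <;> linarith [h0.1, h0.2, h1.1, h1.2]

theorem norm_step_pow_le_of_parabolic {x E : ℝ} (h : |E - x| = 2) (j : ℕ) :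
    ‖step x E ^ j‖ ≤ 2 * ((j : ℝ) + 1) ^ (1 : ℝ) := by
  obtain ⟨s, hs, hx⟩ : ∃ s : ℝ, |s| = 1 ∧ E - x = 2 * s := by
    refine ⟨(E - x) / 2, ?_, by ring⟩
    rw [abs_div, h]
    norm_num
  have hs2 : s * s = 1 := by rw [← abs_mul_abs_self, hs, one_mul]
  -- Closed form for a double eigenvalue s = ±1; `s ^ j * s` stands for s^(j-1), as s² = 1.
  have hent : ∀ j : ℕ, (transfer x E ^ j) 0 0 = s ^ j * (j + 1) ∧
      (transfer x E ^ j) 1 0 = s ^ j * s * j ∧ (transfer x E ^ j) 0 1 = -(s ^ j * s * j) ∧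
      (transfer x E ^ j) 1 1 = -(s ^ j * (j - 1)) := by
    intro j
    induction j with
    | zero => simp
    | succ j ih =>
      obtain ⟨i1, i2, i3, i4⟩ := ih
      obtain ⟨h0, h1⟩ := transfer_pow_succ_apply x E j 0
      obtain ⟨h2, h3⟩ := transfer_pow_succ_apply x E j 1
      rw [h0, h1, h2, h3, i1, i2, i3, i4, hx]
      push_cast
      refine ⟨by ring, ?_, ?_, by ring⟩
      · linear_combination -(s ^ j * (j + 1)) * hs2
      · linear_combination -(s ^ j * (j - 1)) * hs2
  obtain ⟨i1, i2, i3, i4⟩ := hent j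
  have hj : (0 : ℝ) ≤ j := Nat.cast_nonneg j
  have hj1 : |(j : ℝ) - 1| ≤ j + 1 := abs_le.2 ⟨by linarith, by linarith⟩
  have hj2 : |(j : ℝ) + 1| = j + 1 := abs_of_nonneg (by linarith)
  rw [step_ofReal_pow, Real.rpow_one]
  apply norm_fin_two_le <;>
    simp only [RingHom.mapMatrix_apply, Matrix.map_apply, Complex.ofRealHom_eq_coe,
      Complex.norm_real, i1, i2, i3, i4, Real.norm_eq_abs, abs_mul, abs_neg, abs_pow, hs, one_pow,
      one_mul, mul_one, Nat.abs_cast] <;> linarith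

theorem norm_pow_pow_le {A : Matrix (Fin 2) (Fin 2) ℂ} {C α : ℝ} (hα : 0 ≤ α)
    (hA : ∀ j : ℕ, ‖A ^ j‖ ≤ C * ((j : ℝ) + 1) ^ α) (k j : ℕ) :
    ‖(A ^ k) ^ j‖ ≤ C * ((k : ℝ) + 1) ^ α * ((j : ℝ) + 1) ^ α := by
  have hC : 0 ≤ C := by
    have := (norm_nonneg _).trans (hA 0)
    simpa using this
  rw [← pow_mul, mul_assoc, ← Real.mul_rpow (by positivity) (by positivity)]
  refine (hA _).trans ?_
  gcongr
  push_cast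
  nlinarith [(Nat.cast_nonneg k : (0 : ℝ) ≤ k), (Nat.cast_nonneg j : (0 : ℝ) ≤ j)]

/-! ## Resonant energies -/

/-- These relations express that a power is a combination of I and the matrix itself. It is
therefore scalar once its lower left entry vanishes, and determinant one then forces ±I. -/
theorem transfer_pow_entries (x E : ℝ) (j : ℕ) :
    (transfer x E ^ j) 0 1 = -(transfer x E ^ j) 1 0 ∧
      (transfer x E ^ j) 0 0 - (transfer x E ^ j) 1 1 = (E - x) * (transfer x E ^ j) 1 0 := by
  induction j with
  | zero => simp
  | succ j ih =>
    obtain ⟨h0, h1⟩ := transfer_pow_succ_apply x E j 0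
    obtain ⟨h2, h3⟩ := transfer_pow_succ_apply x E j 1
    rw [h0, h1, h2, h3]
    constructor
    · linear_combination (E - x) * ih.1 + ih.2
    · linear_combination -ih.1

theorem mem_resonantEnergies_iff {x E : ℝ} {k : ℕ} :
    E ∈ resonantEnergies x k ↔ (transfer x E ^ k) 1 0 = 0 := by
  constructor
  · rintro (h | h) <;> simp [h]
  · intro h
    obtain ⟨h1, h2⟩ := transfer_pow_entries x E k
    rw [h, neg_zero] at h1
    rw [h, mul_zero, sub_eq_zero] at h2
    have hdet : (transfer x E ^ k).det = 1 := by rw [Matrix.det_pow]; simp [transfer]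
    rw [Matrix.det_fin_two, h1, h2, zero_mul, sub_zero, mul_self_eq_one_iff] at hdet
    refine hdet.imp (fun hd => ?_) (fun hd => ?_)
    · ext i j
      fin_cases i <;> fin_cases j <;> simp [h, h1, h2, hd]
    · ext i j
      fin_cases i <;> fin_cases j <;> simp [h, h1, h2, hd]

open Polynomial in
theorem transfer_pow_eq_eval_U (x E : ℝ) (j : ℕ) :
    (transfer x E ^ (j + 1)) 1 0 = (Chebyshev.U ℝ j).eval ((E - x) / 2) ∧
      (transfer x E ^ (j + 1)) 0 0 = (Chebyshev.U ℝ (j + 1)).eval ((E - x) / 2) := by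
  induction j with
  | zero => simp [transfer]; ring
  | succ j ih =>
    obtain ⟨h0, h1⟩ := transfer_pow_succ_apply x E (j + 1) 0
    rw [h0, h1, ih.1, ih.2]
    refine ⟨by push_cast; rfl, ?_⟩
    push_cast
    rw [show (j : ℤ) + 1 + 1 = j + 2 by ring, Chebyshev.U_add_two, eval_sub, eval_mul,
      eval_mul, eval_X, eval_ofNat]
    ring

open Polynomial in
-- The lower left entry of the k-th power is U_{k-1}((E - x)/2), and U_{k-1} has k - 1 distinct real
-- roots.
theorem encard_resonantEnergies (x : ℝ) {k : ℕ} (hk : 1 ≤ k) :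
    (resonantEnergies x k).encard = ((k - 1 : ℕ) : ℕ∞) := by
  obtain ⟨j, rfl⟩ : ∃ j, k = j + 1 := ⟨k - 1, by omega⟩
  have hroots := Chebyshev.roots_U_real j
  have hU : Chebyshev.U ℝ j ≠ 0 := by
    intro h
    have := Chebyshev.U_eval_one (R := ℝ) j
    rw [h] at this
    simp at this
    linarith [(Nat.cast_nonneg j : (0 : ℝ) ≤ j)]
  have hset : resonantEnergies x (j + 1)
      = (fun y => x + 2 * y) '' ((Chebyshev.U ℝ j).roots.toFinset : Set ℝ) := by
    ext E
    rw [mem_resonantEnergies_iff, (transfer_pow_eq_eval_U x E j).1]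
    simp only [Set.mem_image, Finset.mem_coe, Multiset.mem_toFinset, mem_roots hU, IsRoot.def]
    constructor
    · exact fun h => ⟨_, h, by ring⟩
    · rintro ⟨y, hy, rfl⟩
      rwa [show (x + 2 * y - x) / 2 = y by ring]
  have hinj : Function.Injective fun y : ℝ => x + 2 * y := fun y z h => by
    simpa using h
  rw [hset, hinj.encard_image, Set.encard_coe_eq_coe_finsetCard, hroots]
  rw [Finset.val_toFinset, Finset.card_image_of_injOn
    ((Finset.range j).nodup_map_iff_injOn.1 (Chebyshev.roots_U_real_nodup j)), Finset.card_range,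
    add_tsub_cancel_right]

theorem step_pow_of_mem_resonantEnergies {x E : ℝ} {k : ℕ} (h : E ∈ resonantEnergies x k) :
    step x E ^ k = 1 ∨ step x E ^ k = -1 := by
  rw [step_ofReal_pow]
  rcases h with h | h <;> rw [h]
  · exact Or.inl (map_one _)
  · exact Or.inr (by rw [map_neg, map_one])

theorem self_mem_resonantEnergies (x : ℝ) {k : ℕ} (hk : Even k) : x ∈ resonantEnergies x k := by
  obtain ⟨j, rfl⟩ := hk
  have h2 : transfer x x ^ 2 = -1 := by
    rw [pow_two]
    ext i l
    fin_cases i <;> fin_cases l <;> simp [transfer, Matrix.mul_apply, Fin.sum_univ_two]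
  change _ ∨ _
  rw [← two_mul, pow_mul, h2]
  exact neg_one_pow_eq_or _ j

/-- At a resonance the factor from a^m is ±I, so the order inside the blocks is irrelevant and both
give ±`step b E ^ n`. -/
theorem le_betaMinus_of_resonant_a {m n : ℕ} (hm : 1 ≤ m) (hn : 1 ≤ n) {a b E : ℝ}
    {ω : ℤ → Letter} (hω : ω ∈ subshift m n) (hE : E ∈ resonantEnergies a m) {C α : ℝ}
    (hα : 0 ≤ α) (hC : ∀ j : ℕ, ‖step b E ^ j‖ ≤ C * ((j : ℝ) + 1) ^ α) {p : ℝ} (hp : 0 < p) :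
    (((p - 1 - 4 * α) / (1 + α) : ℝ) : EReal) ≤ betaMinus (potential a b ω) p := by
  refine le_betaMinus_of_blocks (E := E) hω (B := step b E ^ n) (L := m + n) (by omega) hα (fun q => ?_)
    (norm_pow_pow_le hα hC n) hp
  have hres := step_pow_of_mem_resonantEnergies hE
  cases hq : fixedPoint m n q
  · rw [cocycle_fixedPoint_of_eq_a (fun c => step (letterValue a b c) E) hm hn hq]
    simp only [letterValue]
    exact hres.imp (fun h => by rw [h, mul_one]) (fun h => by rw [h, mul_neg, mul_one])
  · rw [cocycle_fixedPoint_of_eq_b (fun c => step (letterValue a b c) E) hm hn hq]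
    simp only [letterValue]
    exact hres.imp (fun h => by rw [h, one_mul]) (fun h => by rw [h, neg_mul, one_mul])

theorem le_betaMinus_of_resonant_b {m n : ℕ} (hm : 1 ≤ m) (hn : 1 ≤ n) {a b E : ℝ}
    {ω : ℤ → Letter} (hω : ω ∈ subshift m n) (hE : E ∈ resonantEnergies b n) {C α : ℝ}
    (hα : 0 ≤ α) (hC : ∀ j : ℕ, ‖step a E ^ j‖ ≤ C * ((j : ℝ) + 1) ^ α) {p : ℝ} (hp : 0 < p) :
    (((p - 1 - 4 * α) / (1 + α) : ℝ) : EReal) ≤ betaMinus (potential a b ω) p := by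
  refine le_betaMinus_of_blocks (E := E) hω (B := step a E ^ m) (L := m + n) (by omega) hα (fun q => ?_)
    (norm_pow_pow_le hα hC m) hp
  have hres := step_pow_of_mem_resonantEnergies hE
  cases hq : fixedPoint m n q
  · rw [cocycle_fixedPoint_of_eq_a (fun c => step (letterValue a b c) E) hm hn hq]
    simp only [letterValue]
    exact hres.imp (fun h => by rw [h, one_mul]) (fun h => by rw [h, neg_mul, one_mul])
  · rw [cocycle_fixedPoint_of_eq_b (fun c => step (letterValue a b c) E) hm hn hq]
    simp only [letterValue]
    exact hres.imp (fun h => by rw [h, mul_one]) (fun h => by rw [h, mul_neg, mul_one])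

theorem elliptic_or_parabolic_imp {x E p : ℝ} {β : EReal}
    (h : ∀ C α : ℝ, 0 ≤ α → (∀ j : ℕ, ‖step x E ^ j‖ ≤ C * ((j : ℝ) + 1) ^ α) →
      (((p - 1 - 4 * α) / (1 + α) : ℝ) : EReal) ≤ β) :
    (|x - E| < 2 → ((p - 1 : ℝ) : EReal) ≤ β) ∧
      (|x - E| = 2 → (((p - 5) / 2 : ℝ) : EReal) ≤ β) := by
  rw [abs_sub_comm]
  constructor
  · intro hx
    obtain ⟨C, hC⟩ := exists_norm_step_pow_le_of_elliptic hx
    have := h C 0 le_rfl (fun j => by simpa using hC j)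
    simpa using this
  · intro hx
    have := h 2 1 zero_le_one (norm_step_pow_le_of_parabolic hx)
    convert this using 2
    ring

/-! ## The Thue-Morse substitution -/

/-- The hypothesis makes the product traceless with determinant one; Cayley–Hamilton predicts square
-1. -/
theorem step_mul_step_sq {x y : ℝ} {E : ℂ} (h : (E - x) * (E - y) = 2) :
    step y E * step x E * (step y E * step x E) = -1 := by
  have e : step y E * step x E = !![1, -(E - y); E - x, -1] := by
    ext i j
    fin_cases i <;> fin_cases j <;> simp [step, Matrix.mul_apply, Fin.sum_univ_two]
    linear_combination h
  rw [e]
  ext i j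
  fin_cases i <;> fin_cases j <;> simp [Matrix.mul_apply, Fin.sum_univ_two]
  · linear_combination -h
  · linear_combination -h

theorem le_betaMinus_thueMorse {a b : ℝ} {ω : ℤ → Letter} (hω : ω ∈ subshift 1 1) {p : ℝ}
    (hp : 0 < p) : ((p - 1 : ℝ) : EReal) ≤ betaMinus (potential a b ω) p := by
  obtain ⟨E, hE⟩ : ∃ E : ℝ, (E - a) * (E - b) = 2 := by
    -- The larger root of the quadratic in `E`; its discriminant (a - b)² + 8 is positive.
    refine ⟨(a + b + Real.sqrt ((a - b) ^ 2 + 8)) / 2, ?_⟩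
    have := Real.sq_sqrt (show 0 ≤ (a - b) ^ 2 + 8 by positivity)
    linear_combination this / 4
  have hE' : ((E : ℂ) - a) * (E - b) = 2 := by exact_mod_cast hE
  set A := step a E with hA
  set B := step b E with hB
  have hBA : B * A * (B * A) = -1 := step_mul_step_sq hE'
  have hAB : A * B * (A * B) = -1 := step_mul_step_sq (by rw [mul_comm, hE'])
  set f : ℕ → Matrix (Fin 2) (Fin 2) ℂ :=
    fun k => step (letterValue a b (fixedPoint 1 1 k)) E with hf
  have hlet : ∀ q, (fixedPoint 1 1 q = Letter.a ∧ fixedPoint 1 1 (2 * q) = Letter.a ∧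
      fixedPoint 1 1 (2 * q + 1) = Letter.b) ∨ (fixedPoint 1 1 q = Letter.b ∧
      fixedPoint 1 1 (2 * q) = Letter.b ∧ fixedPoint 1 1 (2 * q + 1) = Letter.a) := by
    intro q
    have h0 := getElem?_substLetter_fixedPoint le_rfl le_rfl q 0 (by norm_num)
    have h1 := getElem?_substLetter_fixedPoint le_rfl le_rfl q 1 (by norm_num)
    rw [show q * (1 + 1) + 0 = 2 * q by ring] at h0
    rw [show q * (1 + 1) + 1 = 2 * q + 1 by ring] at h1
    cases hq : fixedPoint 1 1 q <;> rw [hq] at h0 h1 <;> simp [substLetter] at h0 h1 <;>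
      simp [← h0, ← h1]
  have hsplit : ∀ q l, cocycle (fun k => f (q * (l + l) + k)) (l + l)
      = cocycle (fun k => f ((2 * q + 1) * l + k)) l
        * cocycle (fun k => f (2 * q * l + k)) l := by
    intro q l
    rw [cocycle_add]
    have e1 : ∀ k, q * (l + l) + (l + k) = (2 * q + 1) * l + k := fun k => by ring
    have e2 : ∀ k, q * (l + l) + k = 2 * q * l + k := fun k => by ring
    simp only [e1, e2]
  have h2 : ∀ q, (fixedPoint 1 1 q = Letter.a → cocycle (fun k => f (q * 2 + k)) 2 = B * A) ∧
      (fixedPoint 1 1 q = Letter.b → cocycle (fun k => f (q * 2 + k)) 2 = A * B) := by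
    refine fun q => ⟨fun hq => ?_, fun hq => ?_⟩
    · have := cocycle_fixedPoint_of_eq_a (fun c => step (letterValue a b c) E) le_rfl le_rfl hq
      rwa [pow_one, pow_one] at this
    · have := cocycle_fixedPoint_of_eq_b (fun c => step (letterValue a b c) E) le_rfl le_rfl hq
      rwa [pow_one, pow_one] at this
  have h4 : ∀ q, (fixedPoint 1 1 q = Letter.a →
        cocycle (fun k => f (q * 4 + k)) 4 = A * B * (B * A)) ∧
      (fixedPoint 1 1 q = Letter.b → cocycle (fun k => f (q * 4 + k)) 4 = B * A * (A * B)) := by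
    intro q
    rw [hsplit q 2]
    rcases hlet q with ⟨h, ha, hb⟩ | ⟨h, hb, ha⟩ <;> rw [(h2 _).1 ha, (h2 _).2 hb] <;> simp [h]
  -- In S³(a) and S³(b) the two middle pairs agree, so they multiply to -1; the outer pairs then
  -- meet and give another -1.
  have h8 : ∀ q, cocycle (fun k => f (q * 8 + k)) 8 = 1 := by
    intro q
    rw [hsplit q 4]
    rcases hlet q with ⟨h, ha, hb⟩ | ⟨h, hb, ha⟩ <;> rw [(h4 _).1 ha, (h4 _).2 hb]
    · calc B * A * (A * B) * (A * B * (B * A)) = B * A * (A * B * (A * B)) * (B * A) := by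
            noncomm_ring
        _ = 1 := by rw [hAB, mul_neg, mul_one, neg_mul, hBA, neg_neg]
    · calc A * B * (B * A) * (B * A * (A * B)) = A * B * (B * A * (B * A)) * (A * B) := by
            noncomm_ring
        _ = 1 := by rw [hBA, mul_neg, mul_one, neg_mul, hAB, neg_neg]
  have key := le_betaMinus_of_blocks (a := a) (b := b) (E := E) hω (B := 1) (L := 8) (C := 1)
    (α := 0) (by norm_num) le_rfl (fun q => Or.inl (h8 q)) (fun j => by simp) hp
  simpa using key

end ThueMorseDynamics

end
theorem corollary4p6 (m n : ℕ) (hm : 1 ≤ m) (hn : 1 ≤ n) (a b : ℝ) :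
    ((Even m ∨ Even n) →
      ∀ ω ∈ ThueMorseDynamics.subshift m n, ∀ p : ℝ, 0 < p →
        (|a - b| < 2 →
          ((p - 1 : ℝ) : EReal) ≤
            ThueMorseDynamics.betaMinus (ThueMorseDynamics.potential a b ω) p) ∧
        (|a - b| = 2 →
          (((p - 5) / 2 : ℝ) : EReal) ≤
            ThueMorseDynamics.betaMinus (ThueMorseDynamics.potential a b ω) p)) ∧
    (3 ≤ m → Odd m →
      (ThueMorseDynamics.resonantEnergies a m).encard = ((m - 1 : ℕ) : ℕ∞) ∧
      ∀ E₀ ∈ ThueMorseDynamics.resonantEnergies a m,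
        ∀ ω ∈ ThueMorseDynamics.subshift m n, ∀ p : ℝ, 0 < p →
          (|b - E₀| < 2 →
            ((p - 1 : ℝ) : EReal) ≤
              ThueMorseDynamics.betaMinus (ThueMorseDynamics.potential a b ω) p) ∧
          (|b - E₀| = 2 →
            (((p - 5) / 2 : ℝ) : EReal) ≤
              ThueMorseDynamics.betaMinus (ThueMorseDynamics.potential a b ω) p)) ∧
    (3 ≤ n → Odd n →
      (ThueMorseDynamics.resonantEnergies b n).encard = ((n - 1 : ℕ) : ℕ∞) ∧
      ∀ E₀ ∈ ThueMorseDynamics.resonantEnergies b n,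
        ∀ ω ∈ ThueMorseDynamics.subshift m n, ∀ p : ℝ, 0 < p →
          (|a - E₀| < 2 →
            ((p - 1 : ℝ) : EReal) ≤
              ThueMorseDynamics.betaMinus (ThueMorseDynamics.potential a b ω) p) ∧
          (|a - E₀| = 2 →
            (((p - 5) / 2 : ℝ) : EReal) ≤
              ThueMorseDynamics.betaMinus (ThueMorseDynamics.potential a b ω) p)) ∧
    (m = 1 → n = 1 →
      ∀ ω ∈ ThueMorseDynamics.subshift m n, ∀ p : ℝ, 0 < p →
        ((p - 1 : ℝ) : EReal) ≤
          ThueMorseDynamics.betaMinus (ThueMorseDynamics.potential a b ω) p) := by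
  have ha := fun E (hE : E ∈ ThueMorseDynamics.resonantEnergies a m) ω
      (hω : ω ∈ ThueMorseDynamics.subshift m n) (p : ℝ) (hp : 0 < p) =>
    ThueMorseDynamics.elliptic_or_parabolic_imp fun _ _ hα hC =>
      ThueMorseDynamics.le_betaMinus_of_resonant_a (a := a) (b := b) hm hn hω hE hα hC hp
  have hb := fun E (hE : E ∈ ThueMorseDynamics.resonantEnergies b n) ω
      (hω : ω ∈ ThueMorseDynamics.subshift m n) (p : ℝ) (hp : 0 < p) =>
    ThueMorseDynamics.elliptic_or_parabolic_imp fun _ _ hα hC =>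
      ThueMorseDynamics.le_betaMinus_of_resonant_b (a := a) (b := b) hm hn hω hE hα hC hp
  refine ⟨?_, fun _ _ => ⟨ThueMorseDynamics.encard_resonantEnergies a hm, ha⟩,
    fun _ _ => ⟨ThueMorseDynamics.encard_resonantEnergies b hn, hb⟩, ?_⟩
  · rintro (h | h) ω hω p hp
    · rw [abs_sub_comm]
      -- For even m the energy E = a is itself resonant, and the distance to the other letter is |b
      -- - a|.
      exact ha a (ThueMorseDynamics.self_mem_resonantEnergies a h) ω hω p hp
    · exact hb b (ThueMorseDynamics.self_mem_resonantEnergies b h) ω hω p hp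
  · rintro rfl rfl ω hω p hp
    exact ThueMorseDynamics.le_betaMinus_thueMorse hω hp
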